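/- **Proposition 2.4.** Let $R$ be a commutative ring, let $p$ be a prime number, write $R/p = R/pR$, and let $Y$ be a topological space such that the singular cohomology $H^n(Y;R)$ is a finitely generated free $R$-module for every $n \geq 0$. Assume that at least one of the following holds: * $R$ is Noetherian of finite Krull dimension; * $Y$ has finite type, i.e. $Y$ is homotopy equivalent to a CW complex with finitely many cells in each dimension. For a commutative ring $A$ let $H^*(Y;A) = \bigoplus_{n \ge 0} H^n(Y;A)$ be the singular cohomology algebra with the cup product. Then the natural maps $$H^*(Y;R)\otimes_R R/p \longrightarrow H^*(Y;R/p) \longleftarrow H^*(Y;\mathbb{F}_p)\otimes_{\mathbb{F}_p} R/p,$$ which send $x \otimes a$, with $x$ of degree $n$, to $a$ times the image of $x$ in $H^n(Y;R/p)$ under the map induced by the ring homomorphism $R \to R/p$ (respectively $\mathbb{F}_p \to R/p$) of coefficients, are isomorphisms of graded $R/p$-algebras. -/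

import Mathlib

universe u v w

/-! ### Cochains of a simplicial set, their cohomology, and the cup product -/

namespace SSetCochain

open CategoryTheory

section Cohomology

open Opposite
open scoped Simplicial

/-- The module of `n`-cochains of a simplicial set with coefficients in `R`:
all functions from `n`-simplices to `R`, i.e. `Hom(ℤ[Xₙ], R)`. -/
abbrev Cochain (R : Type v) (X : SSet.{u}) (n : ℕ) : Type (max u v) := X _⦋n⦌ → R

/-- The coboundary `(dφ)(σ) = ∑ k, (-1) ^ k φ(∂ₖ σ)`. -/
def d (R : Type v) [CommRing R] (X : SSet.{u}) (n : ℕ) :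
    Cochain R X n →ₗ[R] Cochain R X (n + 1) where
  toFun φ σ := ∑ k : Fin (n + 2), (-1) ^ (k : ℕ) * φ (X.δ k σ)
  map_add' φ ψ := by
    funext σ
    simp [mul_add, Finset.sum_add_distrib]
  map_smul' r φ := by
    funext σ
    simp [Finset.mul_sum, mul_left_comm]

/-- The face of an `n`-simplex spanned by the vertices `j, j + 1, …, j + l`. -/
def face {X : SSet.{u}} {n : ℕ} (j l : ℕ) (h : j + l ≤ n) (σ : X _⦋n⦌) : X _⦋l⦌ :=
  X.map (SimplexCategory.subinterval j l h).op σ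

/-- The cup product `(φ ∪ ψ)(σ) = φ(σ|[0, …, i]) ψ(σ|[i, …, i + j])` of cochains. -/
def cup {R : Type v} [CommRing R] {X : SSet.{u}} {i j n : ℕ} (h : i + j = n)
    (φ : Cochain R X i) (ψ : Cochain R X j) : Cochain R X n :=
  fun σ ↦ φ (face 0 i (by omega) σ) * ψ (face i j (by omega) σ)

variable {R : Type v} [CommRing R] {X : SSet.{u}}

lemma subinterval_val {n : ℕ} (j l : ℕ) (h : j + l ≤ n) (i : Fin (l + 1)) :
    ((SimplexCategory.Hom.toOrderHom (SimplexCategory.subinterval j l h) i : Fin (n + 1)) : ℕ)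
      = i + j := rfl

lemma δ_val {n : ℕ} (k : Fin (n + 2)) (i : Fin (n + 1)) :
    ((SimplexCategory.Hom.toOrderHom (SimplexCategory.δ k) i : Fin (n + 2)) : ℕ)
      = if (i : ℕ) < k then (i : ℕ) else i + 1 := by
  simp only [SimplexCategory.δ, SimplexCategory.mkHom, SimplexCategory.Hom.toOrderHom_mk,
    OrderEmbedding.toOrderHom_coe, Fin.succAboveOrderEmb_apply, Fin.succAbove, Fin.lt_def,
    Fin.val_castSucc]
  split_ifs <;> simp

lemma face_face {n m : ℕ} (j l : ℕ) (h : j + l ≤ m) (j' : ℕ) (h' : j' + m ≤ n) (σ : X _⦋n⦌) :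
    face j l h (face j' m h' σ) = face (j' + j) l (by omega) σ := by
  unfold face
  rw [← ConcreteCategory.comp_apply, ← X.map_comp, ← op_comp]
  congr 4
  ext i
  simp only [SimplexCategory.comp_toOrderHom, OrderHom.comp_coe, Function.comp_apply]
  rw [subinterval_val, subinterval_val, subinterval_val]
  omega

lemma face_full {n : ℕ} (h : 0 + n ≤ n) (σ : X _⦋n⦌) : face 0 n h σ = σ := by
  unfold face
  have : SimplexCategory.subinterval 0 n h = 𝟙 ⦋n⦌ := by
    ext i
    rw [subinterval_val]
    simp
  rw [this]
  simp

lemma face_δ_low {n l : ℕ} (j : ℕ) (h : j + l ≤ n) (k : Fin (n + 2)) (hk : (k : ℕ) ≤ j)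
    (σ : X _⦋n + 1⦌) : face j l h (X.δ k σ) = face (j + 1) l (by omega) σ := by
  unfold face SimplicialObject.δ
  rw [← ConcreteCategory.comp_apply, ← X.map_comp, ← op_comp]
  congr 4
  ext i
  simp only [SimplexCategory.comp_toOrderHom, OrderHom.comp_coe, Function.comp_apply]
  rw [δ_val, subinterval_val, subinterval_val]
  split_ifs <;> omega

lemma face_δ_high {n l : ℕ} (j : ℕ) (h : j + l ≤ n) (k : Fin (n + 2)) (hk : j + l < (k : ℕ))
    (σ : X _⦋n + 1⦌) : face j l h (X.δ k σ) = face j l (by omega) σ := by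
  unfold face SimplicialObject.δ
  rw [← ConcreteCategory.comp_apply, ← X.map_comp, ← op_comp]
  congr 4
  ext i
  have hi : (i : ℕ) < l + 1 := i.2
  simp only [SimplexCategory.comp_toOrderHom, OrderHom.comp_coe, Function.comp_apply]
  rw [δ_val, subinterval_val, subinterval_val]
  split_ifs <;> omega

lemma face_δ_mid {n l : ℕ} (j : ℕ) (h : j + l ≤ n) (k : Fin (n + 2)) (m : Fin (l + 2))
    (hk : (k : ℕ) = j + m) (σ : X _⦋n + 1⦌) :
    face j l h (X.δ k σ) = X.δ m (face j (l + 1) (by omega) σ) := by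
  unfold face SimplicialObject.δ
  rw [← ConcreteCategory.comp_apply, ← X.map_comp, ← op_comp,
    ← ConcreteCategory.comp_apply, ← X.map_comp, ← op_comp]
  congr 4
  ext i
  simp only [SimplexCategory.comp_toOrderHom, OrderHom.comp_coe, Function.comp_apply]
  rw [δ_val, subinterval_val, subinterval_val, δ_val]
  split_ifs <;> omega

lemma sum_fin_split {M : Type*} [AddCommMonoid M] {a b c : ℕ} (h : a + b = c) (f : Fin c → M) :
    ∑ k, f k = ∑ k : Fin a, f ⟨k, by omega⟩ + ∑ k : Fin b, f ⟨a + k, by omega⟩ := by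
  subst h
  exact Fin.sum_univ_add f

/-- The Leibniz rule `d(φ ∪ ψ) = dφ ∪ ψ + (-1) ^ i φ ∪ dψ`. -/
lemma d_cup {i j n : ℕ} (h : i + j = n) (φ : Cochain R X i) (ψ : Cochain R X j) :
    d R X n (cup h φ ψ) = cup (n := n + 1) (by omega) (d R X i φ) ψ +
      (-1 : R) ^ i • cup (n := n + 1) (by omega) φ (d R X j ψ) := by
  funext σ
  simp only [d, cup, LinearMap.coe_mk, AddHom.coe_mk, Pi.add_apply, Pi.smul_apply, smul_eq_mul]
  rw [sum_fin_split (a := i + 1) (b := j + 1) (by omega),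
    sum_fin_split (a := i + 1) (b := 1) (c := i + 2) (by omega),
    sum_fin_split (a := 1) (b := j + 1) (c := j + 2) (by omega)]
  simp only [Finset.univ_unique, Fin.default_eq_zero, Finset.sum_singleton, Fin.val_zero,
    add_mul, mul_add, Finset.sum_mul, Finset.mul_sum, add_zero, pow_zero, one_mul]
  have h1 : ∀ k : Fin (i + 1), (-1 : R) ^ (k : ℕ) *
      (φ (face 0 i (by omega) (X.δ ⟨k, by omega⟩ σ)) *
        ψ (face i j (by omega) (X.δ ⟨k, by omega⟩ σ))) =
      (-1) ^ (k : ℕ) * φ (X.δ ⟨k, by omega⟩ (face 0 (i + 1) (by omega) σ)) *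
        ψ (face (i + 1) j (by omega) σ) := by
    intro k
    rw [face_δ_mid 0 _ _ ⟨k, by omega⟩ (by simp), face_δ_low i _ _ (by simp; omega), mul_assoc]
  have h2 : ∀ k : Fin (j + 1), (-1 : R) ^ (i + 1 + k : ℕ) *
      (φ (face 0 i (by omega) (X.δ ⟨i + 1 + k, by omega⟩ σ)) *
        ψ (face i j (by omega) (X.δ ⟨i + 1 + k, by omega⟩ σ))) =
      (-1) ^ i * (φ (face 0 i (by omega) σ) * ((-1) ^ (1 + k : ℕ) *
        ψ (X.δ ⟨1 + k, by omega⟩ (face i (j + 1) (by omega) σ)))) := by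
    intro k
    rw [face_δ_high 0 _ _ (by simp; omega), face_δ_mid i _ _ ⟨1 + k, by omega⟩ (by simp; omega)]
    ring
  have h3 : φ (X.δ ⟨i + 1, by omega⟩ (face 0 (i + 1) (by omega) σ)) =
      φ (face 0 i (by omega) σ) := by
    rw [← face_full (by omega) (X.δ (⟨i + 1, by omega⟩ : Fin (i + 2)) _),
      face_δ_high 0 (by omega) _ (by simp), face_face]
  have h4 : ψ (X.δ ⟨0, by omega⟩ (face i (j + 1) (by omega) σ)) =
      ψ (face (i + 1) j (by omega) σ) := by
    rw [← face_full (by omega) (X.δ (⟨0, by omega⟩ : Fin (j + 2)) _),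
      face_δ_low 0 (by omega) _ (by simp), face_face]
  rw [Finset.sum_congr rfl (fun k _ ↦ h1 k), Finset.sum_congr rfl (fun k _ ↦ h2 k), h3, h4]
  ring

lemma cup_assoc {i j k m n l : ℕ} (hm : i + j = m) (hn : j + k = n) (hl : m + k = l)
    (hl' : i + n = l) (φ : Cochain R X i) (ψ : Cochain R X j) (χ : Cochain R X k) :
    cup hl (cup hm φ ψ) χ = cup hl' φ (cup hn ψ χ) := by
  subst hm hn
  funext σ
  simp only [cup, face_face, zero_add, add_zero]
  rw [mul_assoc]

lemma one_cup {n : ℕ} (h : 0 + n = n) (φ : Cochain R X n) : cup h 1 φ = φ := by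
  funext σ
  simp [cup, face_full]

lemma cup_one {n : ℕ} (h : n + 0 = n) (φ : Cochain R X n) : cup h φ 1 = φ := by
  funext σ
  simp [cup, face_full]

lemma d_one : d R X 0 1 = 0 := by
  funext σ
  simp [d, Fin.sum_univ_two]

end Cohomology

/-! ### Cohomology as a graded algebra -/

section Algebra

/-- The cocycles of degree `n`. -/
def Z (R : Type v) [CommRing R] (X : SSet.{u}) (n : ℕ) : Submodule R (Cochain R X n) :=
  LinearMap.ker (d R X n)

/-- The coboundaries of degree `n`. -/
def B (R : Type v) [CommRing R] (X : SSet.{u}) : (n : ℕ) → Submodule R (Cochain R X n)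
  | 0 => ⊥
  | n + 1 => LinearMap.range (d R X n)

/-- The cohomology in degree `n`: cocycles modulo coboundaries. -/
def H (R : Type v) [CommRing R] (X : SSet.{u}) (n : ℕ) : Type (max u v) :=
  Z R X n ⧸ (B R X n).submoduleOf (Z R X n)

instance instAddCommGroupH (R : Type v) [CommRing R] (X : SSet.{u}) (n : ℕ) :
    AddCommGroup (H R X n) :=
  inferInstanceAs (AddCommGroup (Z R X n ⧸ (B R X n).submoduleOf (Z R X n)))

instance instModuleH (R : Type v) [CommRing R] (X : SSet.{u}) (n : ℕ) : Module R (H R X n) :=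
  inferInstanceAs (Module R (Z R X n ⧸ (B R X n).submoduleOf (Z R X n)))

/-- The class of a cocycle. -/
def mkH {R : Type v} [CommRing R] {X : SSet.{u}} {n : ℕ} : Z R X n →ₗ[R] H R X n :=
  Submodule.mkQ _

variable {R : Type v} [CommRing R] {X : SSet.{u}}

lemma cup_mem_Z {i j n : ℕ} (h : i + j = n) {φ : Cochain R X i} {ψ : Cochain R X j}
    (hφ : φ ∈ Z R X i) (hψ : ψ ∈ Z R X j) : cup h φ ψ ∈ Z R X n := by
  have h1 : d R X i φ = 0 := hφ
  have h2 : d R X j ψ = 0 := hψ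
  change d R X n _ = 0
  rw [d_cup, h1, h2]
  funext σ
  simp [cup]

lemma cup_mem_B_left {i j n : ℕ} (h : i + j = n) {φ : Cochain R X i} {ψ : Cochain R X j}
    (hφ : φ ∈ B R X i) (hψ : ψ ∈ Z R X j) : cup h φ ψ ∈ B R X n := by
  have h2 : d R X j ψ = 0 := hψ
  cases i with
  | zero =>
    have h1 : φ = 0 := hφ
    have : cup h φ ψ = 0 := by
      funext σ
      simp [cup, h1]
    rw [this]
    exact zero_mem _
  | succ i =>
    obtain ⟨χ, rfl⟩ := hφ
    obtain ⟨m, rfl⟩ : ∃ m, n = m + 1 := ⟨i + j, by omega⟩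
    refine ⟨cup (by omega) χ ψ, ?_⟩
    rw [d_cup, h2]
    funext σ
    simp [cup]

lemma cup_mem_B_right {i j n : ℕ} (h : i + j = n) {φ : Cochain R X i} {ψ : Cochain R X j}
    (hφ : φ ∈ Z R X i) (hψ : ψ ∈ B R X j) : cup h φ ψ ∈ B R X n := by
  have h2 : d R X i φ = 0 := hφ
  cases j with
  | zero =>
    have h1 : ψ = 0 := hψ
    have : cup h φ ψ = 0 := by
      funext σ
      simp [cup, h1]
    rw [this]
    exact zero_mem _
  | succ j =>
    obtain ⟨χ, rfl⟩ := hψ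
    obtain ⟨m, rfl⟩ : ∃ m, n = m + 1 := ⟨i + j, by omega⟩
    refine ⟨(-1 : R) ^ i • cup (by omega) φ χ, ?_⟩
    rw [map_smul, d_cup, h2, smul_add, smul_smul, ← mul_pow]
    funext σ
    simp [cup]

/-- The cup product of cocycles. -/
def cupZ {i j n : ℕ} (h : i + j = n) : Z R X i →ₗ[R] Z R X j →ₗ[R] Z R X n :=
  LinearMap.mk₂ R (fun a b ↦ ⟨cup h a.1 b.1, cup_mem_Z h a.2 b.2⟩)
    (fun a a' b ↦ Subtype.ext <| funext fun σ ↦ by simp [cup, add_mul])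
    (fun r a b ↦ Subtype.ext <| funext fun σ ↦ by simp [cup, mul_assoc])
    (fun a b b' ↦ Subtype.ext <| funext fun σ ↦ by simp [cup, mul_add])
    (fun r a b ↦ Subtype.ext <| funext fun σ ↦ by simp [cup, mul_left_comm])

lemma mkH_surjective {n : ℕ} : Function.Surjective (mkH : Z R X n →ₗ[R] H R X n) :=
  Submodule.mkQ_surjective _

lemma mkH_eq_zero {n : ℕ} (z : Z R X n) : mkH z = 0 ↔ z.1 ∈ B R X n :=
  Submodule.Quotient.mk_eq_zero _

/-- The cup product on cohomology, `[a] ∪ [b] = [a ∪ b]`. -/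
def cupH (R : Type v) [CommRing R] (X : SSet.{u}) {i j n : ℕ} (h : i + j = n) :
    H R X i →ₗ[R] H R X j →ₗ[R] H R X n :=
  Submodule.liftQ ((B R X i).submoduleOf (Z R X i))
    (LinearMap.mk₂ R
      (fun a ↦ Submodule.mapQ ((B R X j).submoduleOf (Z R X j)) ((B R X n).submoduleOf (Z R X n))
        (cupZ h a) fun b hb ↦ cup_mem_B_right h a.2 hb)
      (fun a a' b ↦ by
        obtain ⟨b, rfl⟩ := mkH_surjective b
        change mkH (cupZ h (a + a') b) = mkH (cupZ h a b) + mkH (cupZ h a' b)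
        rw [map_add, LinearMap.add_apply, map_add])
      (fun r a b ↦ by
        obtain ⟨b, rfl⟩ := mkH_surjective b
        change mkH (cupZ h (r • a) b) = r • mkH (cupZ h a b)
        rw [map_smul, LinearMap.smul_apply, map_smul])
      (fun a b b' ↦ map_add _ b b')
      (fun r a b ↦ map_smul _ r b))
    (fun a ha ↦ by
      refine LinearMap.ext fun b ↦ ?_
      obtain ⟨b, rfl⟩ := mkH_surjective b
      exact (mkH_eq_zero _).2 (cup_mem_B_left h ha b.2))

lemma cupH_mk {i j n : ℕ} (h : i + j = n) (a : Z R X i) (b : Z R X j) :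
    cupH R X h (mkH a) (mkH b) = mkH (cupZ h a b) := rfl

/-- The class of the constant cochain `1`. -/
def oneH (R : Type v) [CommRing R] (X : SSet.{u}) : H R X 0 := mkH ⟨1, d_one⟩

lemma mk_cup_congr {i j m n : ℕ} (hm : i + j = m) (hn : i + j = n) (a : H R X i) (b : H R X j) :
    (GradedMonoid.mk m (cupH R X hm a b) : GradedMonoid (H R X)) = GradedMonoid.mk n (cupH R X hn a b) := by
  subst hm hn
  rfl

lemma cupH_assoc {i j k m n l : ℕ} (hm : i + j = m) (hn : j + k = n) (hl : m + k = l)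
    (hl' : i + n = l) (a : H R X i) (b : H R X j) (c : H R X k) :
    cupH R X hl (cupH R X hm a b) c = cupH R X hl' a (cupH R X hn b c) := by
  obtain ⟨a, rfl⟩ := mkH_surjective a
  obtain ⟨b, rfl⟩ := mkH_surjective b
  obtain ⟨c, rfl⟩ := mkH_surjective c
  exact congrArg mkH (Subtype.ext (cup_assoc hm hn hl hl' a.1 b.1 c.1))

lemma one_cupH {n : ℕ} (h : 0 + n = n) (a : H R X n) : cupH R X h (oneH R X) a = a := by
  obtain ⟨a, rfl⟩ := mkH_surjective a
  exact congrArg mkH (Subtype.ext (one_cup h a.1))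

lemma cupH_one {n : ℕ} (h : n + 0 = n) (a : H R X n) : cupH R X h a (oneH R X) = a := by
  obtain ⟨a, rfl⟩ := mkH_surjective a
  exact congrArg mkH (Subtype.ext (cup_one h a.1))

instance instGOne : GradedMonoid.GOne (H R X) := ⟨oneH R X⟩

instance instGMul : GradedMonoid.GMul (H R X) := ⟨fun a b ↦ cupH R X rfl a b⟩

/-- Cohomology is a graded ring under the cup product. -/
instance instGRing : DirectSum.GRing (H R X) where
  toGMul := instGMul
  toGOne := instGOne
  mul_zero a := map_zero _
  zero_mul b := by
    change cupH R X rfl 0 b = 0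
    simp
  mul_add a b c := map_add _ b c
  add_mul a b c := by
    change cupH R X rfl (a + b) c = cupH R X rfl a c + cupH R X rfl b c
    simp
  one_mul := by
    rintro ⟨n, a⟩
    exact (mk_cup_congr rfl (zero_add n) (oneH R X) a).trans (congrArg _ (one_cupH _ a))
  mul_one := by
    rintro ⟨n, a⟩
    exact congrArg _ (cupH_one _ a)
  mul_assoc := by
    rintro ⟨i, a⟩ ⟨j, b⟩ ⟨k, c⟩
    refine (congrArg (GradedMonoid.mk (i + j + k))
      (cupH_assoc rfl rfl rfl (add_assoc i j k).symm a b c)).trans ?_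
    exact mk_cup_congr _ _ a (cupH R X rfl b c)
  natCast n := n • (oneH R X)
  natCast_zero := zero_smul _ _
  natCast_succ n := succ_nsmul _ _
  intCast n := n • (oneH R X)
  intCast_ofNat n := natCast_zsmul _ _
  intCast_negSucc_ofNat n := negSucc_zsmul _ _

lemma smul_oneH_cupH {n : ℕ} (h : 0 + n = n) (r : R) (a : H R X n) :
    cupH R X h (r • oneH R X) a = r • a := by
  rw [map_smul, LinearMap.smul_apply, one_cupH]

lemma cupH_smul_oneH {n : ℕ} (h : n + 0 = n) (r : R) (a : H R X n) :
    cupH R X h a (r • oneH R X) = r • a := by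
  rw [map_smul, cupH_one]

/-- Cohomology with coefficients in `R` is a graded `R`-algebra. -/
instance instGAlgebra : DirectSum.GAlgebra R (H R X) where
  toFun := (LinearMap.toSpanSingleton R (H R X 0) (oneH R X)).toAddMonoidHom
  map_one := one_smul R (oneH R X)
  map_mul r s := congrArg (GradedMonoid.mk 0)
    ((mul_smul r s (oneH R X)).trans (smul_oneH_cupH rfl r (s • oneH R X)).symm)
  commutes := by
    rintro r ⟨n, a⟩
    exact (mk_cup_congr rfl (zero_add n) (r • oneH R X) a).trans (congrArg (GradedMonoid.mk n)
      ((smul_oneH_cupH _ r a).trans (cupH_smul_oneH rfl r a).symm))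
  smul_def := by
    rintro r ⟨n, a⟩
    exact (congrArg (GradedMonoid.mk n) (smul_oneH_cupH (zero_add n) r a).symm).trans
      (mk_cup_congr rfl (zero_add n) (r • oneH R X) a).symm

end Algebra

/-! ### Change of coefficients -/

section Coefficients

variable {R : Type v} [CommRing R] {S : Type w} [CommRing S] (f : R →+* S) (X : SSet.{u})

/-- Post-composition of cochains with a ring homomorphism of the coefficients. -/
def coeffCochain (n : ℕ) : Cochain R X n →ₛₗ[f] Cochain S X n where
  toFun φ σ := f (φ σ)
  map_add' _ _ := funext fun _ ↦ map_add f _ _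
  map_smul' _ _ := funext fun _ ↦ map_mul f _ _

lemma d_coeffCochain (n : ℕ) (φ : Cochain R X n) :
    d S X n (coeffCochain f X n φ) = coeffCochain f X (n + 1) (d R X n φ) := by
  funext σ
  simp [d, coeffCochain]

/-- Change of coefficients on cocycles. -/
def coeffZ (n : ℕ) : Z R X n →ₛₗ[f] Z S X n :=
  (coeffCochain f X n).restrict fun φ (hφ : d R X n φ = 0) ↦ by
    change d S X n _ = 0
    rw [d_coeffCochain, hφ, map_zero]

lemma coeffCochain_mem_B (n : ℕ) {φ : Cochain R X n} (hφ : φ ∈ B R X n) :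
    coeffCochain f X n φ ∈ B S X n := by
  cases n with
  | zero =>
    have h : φ = 0 := hφ
    rw [h, map_zero]
    exact zero_mem _
  | succ n =>
    obtain ⟨χ, rfl⟩ := hφ
    exact ⟨coeffCochain f X n χ, d_coeffCochain f X n χ⟩

/-- The map `Hⁿ(X; R) → Hⁿ(X; S)` induced by a ring homomorphism `R → S`. -/
def coeffH (n : ℕ) : H R X n →ₛₗ[f] H S X n :=
  Submodule.mapQ ((B R X n).submoduleOf (Z R X n)) ((B S X n).submoduleOf (Z S X n))
    (coeffZ f X n) fun _ hz ↦ coeffCochain_mem_B f X n hz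

end Coefficients

end SSetCochain

/-! ### Singular cohomology of a topological space -/

/-- The singular cohomology module `Hⁿ(Y; R)`, defined through the simplicial set of continuous maps
from the standard simplices to `Y`. -/
noncomputable abbrev SingularCohomology (R : Type v) [CommRing R] (Y : Type u) [TopologicalSpace Y] (n : ℕ) :
    Type (max u v) :=
  SSetCochain.H R (TopCat.toSSet.obj (TopCat.of Y)) n

/-- The singular cohomology algebra `H^*(Y; R) = ⨁ n, Hⁿ(Y; R)` with the cup product. -/
noncomputable abbrev SingularCohomologyAlgebra (R : Type v) [CommRing R] (Y : Type u) [TopologicalSpace Y] :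
    Type (max u v) :=
  DirectSum ℕ (SingularCohomology R Y)

/-- The inclusion of `Hⁿ(Y; R)` into `H^*(Y; R)`. -/
noncomputable abbrev SingularCohomology.incl (R : Type v) [CommRing R] (Y : Type u) [TopologicalSpace Y] (n : ℕ) :
    SingularCohomology R Y n →ₗ[R] SingularCohomologyAlgebra R Y :=
  DirectSum.lof R ℕ (SingularCohomology R Y) n

/-- The map `Hⁿ(Y; R) → Hⁿ(Y; S)` induced by a ring homomorphism `R → S`. -/
noncomputable abbrev SingularCohomology.coeff {R : Type v} [CommRing R] {S : Type w} [CommRing S] (f : R →+* S)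
    (Y : Type u) [TopologicalSpace Y] (n : ℕ) :
    SingularCohomology R Y n →ₛₗ[f] SingularCohomology S Y n :=
  SSetCochain.coeffH f (TopCat.toSSet.obj (TopCat.of Y)) n

/-- A space has finite type if it is homotopy equivalent to a CW complex with finitely many cells
in each dimension. -/
def HasFiniteType (Y : Type u) [TopologicalSpace Y] : Prop :=
  ∃ (K : Type u) (_ : TopologicalSpace K) (_ : T2Space K)
    (_ : Topology.CWComplex (Set.univ : Set K)),
    Topology.CWComplex.FiniteType (Set.univ : Set K) ∧ Nonempty (ContinuousMap.HomotopyEquiv Y K)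

/-! ### Reduction modulo a prime -/

/-- The unique ring homomorphism from `ℤ/p` to `R/p`. -/
def zmodToModP (R : Type v) [CommRing R] (p : ℕ) : ZMod p →+* ModP R p :=
  (Ideal.Quotient.lift (Ideal.span {(p : ℤ)}) (Int.castRingHom (ModP R p)) (by
    intro a ha
    obtain ⟨b, rfl⟩ := Ideal.mem_span_singleton.1 ha
    have h : ((p : R) : ModP R p) = 0 :=
      Ideal.Quotient.eq_zero_iff_mem.2 (Ideal.mem_span_singleton_self _)
    have h' : ((p : ℕ) : ModP R p) = 0 := by simpa using h
    simp [h'])).comp (Int.quotientSpanNatEquivZMod p).symm.toRingHom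

/-- `R/p` as an algebra over `ℤ/p`. -/
instance zmodAlgebraModP (R : Type v) [CommRing R] (p : ℕ) : Algebra (ZMod p) (ModP R p) :=
  (zmodToModP R p).toAlgebra

open scoped TensorProduct

/-! Let `C` be the integral singular chains and `B_n ⊆ C_n` the boundaries, so that degree `n`
cocycles over `R` are the homomorphisms `C_n → R` vanishing on `B_n`. The cokernel `E_n` of
`Hom(C_n, R) → Hom(B_n, R)` is `Ext(H_n(Y; ℤ), R)`, a direct summand of `H^{n+1}(Y; R)`
(`exists_retraction`); hence it is flat and finite over `R`.

For the first map, reduction `H^n(Y; R) → H^n(Y; R/p)` must be onto with kernel `p H^n(Y; R)`. As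
`p` may be a zero divisor in `R`, there need be no Bockstein sequence, and flatness of `E_n` takes
its place. Surjectivity (`exists_lift_of_comp_eq_zero`): lift a cocycle to `g₁ : C_n → R`; on `B_n`
it equals `p h`, so `p [h] = 0` in `E_n`, and flatness changes `h` by a `p`-torsion homomorphism
into one that extends to some `w` on `C_n`; then `g₁ - p w` is a cocycle. Kernel
(`exists_eq_mul_of_comp_eq_zero`): if a cocycle is `p v`, then `v` maps `B_n` into the `p`-torsion
of `R`. Up to torsion-valued maps that extend, `v` on `B_n` is a finite sum `∑ x_i G_i` with `p x_i
= 0` and `G_i` integral; flatness makes the `G_i` extendable, and the correction can be subtracted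
from `v`. The sum is finite because finiteness of `E_n` bounds the kernel of `B_n/p → C_n/p`
(`finite_modKer`).

For the second map, `H^n(Y; A) = Hom(H_n(Y; 𝔽_p), A)` for every `𝔽_p`-algebra `A`. With `A = R/p`
this is finite over `A` by the first part, so for `A ≠ 0` the space `H_n(Y; 𝔽_p)` is
finite-dimensional and `Hom` commutes with the tensor product. -/

section FreeSubmodule

/-! ### Submodules of free modules over a principal ideal domain. -/

open Module

variable {I : Type*} {k : Type*} [CommRing k] [IsDomain k] [IsPrincipalIdealRing k]

/-- The ideal of leading coefficients at `i` of the elements of `N` supported on `{j | j ≤ i}`. -/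
noncomputable def leadingCoeffIdeal [LinearOrder I] (N : Submodule k (I →₀ k)) (i : I) : Ideal k :=
  (N ⊓ Finsupp.supported k k (Set.Iic i)).map (Finsupp.lapply i)

/-- A submodule of a free module over a principal ideal domain is free. -/
theorem Submodule.free_of_finsupp (N : Submodule k (I →₀ k)) : Module.Free k N := by
  classical
  obtain ⟨_, _⟩ := exists_wellFoundedLT I
  let g : I → k := fun i ↦ Submodule.IsPrincipal.generator (leadingCoeffIdeal N i)
  have hg : ∀ i, ∃ x : I →₀ k, x ∈ N ∧ x ∈ Finsupp.supported k k (Set.Iic i) ∧ x i = g i := by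
    intro i
    obtain ⟨x, ⟨hx, hx'⟩, h⟩ := Submodule.IsPrincipal.generator_mem (leadingCoeffIdeal N i)
    exact ⟨x, hx, hx', h⟩
  choose x hxN hxs hxg using hg
  let J := {i : I // g i ≠ 0}
  let b : J → N := fun j ↦ ⟨x j, hxN j⟩
  -- The `x j` have distinct leading indices: in a relation, only the largest index contributes to
  -- its own coordinate.
  have hli : LinearIndependent k fun j : J ↦ x j := by
    refine linearIndependent_iff.2 fun c hc ↦ ?_
    by_contra hne
    have hs : c.support.Nonempty := Finsupp.support_nonempty_iff.2 hne
    let i := c.support.max' hs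
    have hi : i ∈ c.support := Finset.max'_mem _ _
    have h1 : Finsupp.linearCombination k (fun j : J ↦ x j) c i.1 = 0 := by rw [hc]; rfl
    rw [Finsupp.linearCombination_apply, Finsupp.sum, Finsupp.finsetSum_apply,
      Finset.sum_eq_single i] at h1
    · have h2 : c i * g i = 0 := by
        rw [← hxg i.1]
        exact h1
      rcases mul_eq_zero.1 h2 with h | h
      · exact (Finsupp.mem_support_iff.1 hi) h
      · exact i.2 h
    · intro j hj hji
      have hlt : j < i := lt_of_le_of_ne (Finset.le_max' _ _ hj) hji
      have : x j.1 i.1 = 0 := by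
        by_contra h
        exact absurd ((Finsupp.mem_supported _ _).1 (hxs j.1) (Finsupp.mem_support_iff.2 h))
          (not_le.2 hlt)
      change c j * x j.1 i.1 = 0
      rw [this, mul_zero]
    · exact fun h ↦ absurd hi h
  have hspan : ∀ i : I, ∀ y : N, (y : I →₀ k) ∈ Finsupp.supported k k (Set.Iic i) →
      y ∈ Submodule.span k (Set.range b) := by
    intro i
    induction i using WellFoundedLT.induction with
    | ind i ih =>
      -- Once the coordinate at `i` vanishes, the leading index is below `i` and the induction
      -- hypothesis applies; subtracting a multiple of `x i` reduces to this case.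
      have key : ∀ y : N, (y : I →₀ k) ∈ Finsupp.supported k k (Set.Iic i) →
          (y : I →₀ k) i = 0 → y ∈ Submodule.span k (Set.range b) := by
        intro y hy hyi
        by_cases h0 : y = 0
        · rw [h0]
          exact zero_mem _
        · have hs : (y : I →₀ k).support.Nonempty :=
            Finsupp.support_nonempty_iff.2 fun h ↦ h0 (Subtype.ext h)
          have hm := Finset.max'_mem _ hs
          refine ih _ (lt_of_le_of_ne ((Finsupp.mem_supported _ _).1 hy hm) ?_) y
            ((Finsupp.mem_supported _ _).2 fun j hj ↦ Finset.le_max' _ _ hj)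
          intro h
          rw [h] at hm
          exact Finsupp.mem_support_iff.1 hm hyi
      intro y hy
      have hmem : (y : I →₀ k) i ∈ leadingCoeffIdeal N i :=
        ⟨y, ⟨y.2, hy⟩, rfl⟩
      obtain ⟨c, hc⟩ := (Submodule.IsPrincipal.mem_iff_eq_smul_generator _).1 hmem
      by_cases hgi : g i = 0
      · refine key y hy ?_
        rw [hc]
        exact mul_eq_zero_of_right _ hgi
      · have h := key (y - c • b ⟨i, hgi⟩) (sub_mem hy (Submodule.smul_mem _ _ (hxs i))) (by
          change (y : I →₀ k) i - c • x i i = 0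
          rw [hc, hxg, sub_self])
        have h' := add_mem h (Submodule.smul_mem _ c (Submodule.subset_span ⟨⟨i, hgi⟩, rfl⟩))
        exact (sub_add_cancel y (c • b ⟨i, hgi⟩)) ▸ h'
  refine Module.Free.of_basis (Basis.mk (hli.of_comp N.subtype : LinearIndependent k b) fun y _ ↦ ?_)
  by_cases h0 : y = 0
  · rw [h0]
    exact zero_mem _
  · have hs : (y : I →₀ k).support.Nonempty :=
      Finsupp.support_nonempty_iff.2 fun h ↦ h0 (Subtype.ext h)
    exact hspan ((y : I →₀ k).support.max' hs) y ((Finsupp.mem_supported _ _).2 fun j hj ↦ Finset.le_max' _ _ hj)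

end FreeSubmodule

/-! ### Linear algebra over a field. -/

section FieldAlgebra
open Module TensorProduct

variable {k : Type*} [Field k]

/-- The embedding of `V / ker f` into `W` has a left inverse `l`, through which `g` factors. -/
lemma LinearMap.exists_comp_eq_of_ker_le {V W U : Type*} [AddCommGroup V] [Module k V]
    [AddCommGroup W] [Module k W] [AddCommGroup U] [Module k U] (f : V →ₗ[k] W) (g : V →ₗ[k] U)
    (h : LinearMap.ker f ≤ LinearMap.ker g) : ∃ e : W →ₗ[k] U, e ∘ₗ f = g := by
  obtain ⟨l, hl⟩ := LinearMap.exists_leftInverse_of_injective ((LinearMap.ker f).liftQ f le_rfl)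
    (Submodule.ker_liftQ_eq_bot _ _ _ le_rfl)
  refine ⟨(LinearMap.ker f).liftQ g h ∘ₗ l, LinearMap.ext fun x ↦ ?_⟩
  have hx : l (f x) = (LinearMap.ker f).mkQ x := LinearMap.congr_fun hl ((LinearMap.ker f).mkQ x)
  simp only [LinearMap.comp_apply, hx]
  simp

/-- If `Hom(q, A)` is finite over a nonzero `k`-algebra `A`, then `q` is finite-dimensional. -/
lemma Module.Finite.of_finite_hom {q A : Type*} [AddCommGroup q] [Module k q] [CommRing A]
    [Algebra k A] [Nontrivial A] [Module.Finite A (q →ₗ[k] A)] : Module.Finite k q := by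
  let b := Module.Free.chooseBasis k q
  -- The coordinate functionals of a basis stay independent over `A`, and a finite `A`-module bounds
  -- their number.
  have hli : LinearIndependent A fun j ↦ Algebra.linearMap k A ∘ₗ b.coord j := by
    refine linearIndependent_iff'.2 fun s c hc i hi ↦ ?_
    have h := LinearMap.congr_fun hc (b i)
    rw [LinearMap.sum_apply, Finset.sum_eq_single i] at h
    · simpa using h
    · intro j _ hji
      simp [hji.symm]
    · exact fun h ↦ absurd hi h
  have := hli.finite
  exact Module.Finite.of_basis b

end FieldAlgebra

/-! ### Extension of homomorphisms along `ι : B → S` into `𝔽_p`-vector spaces. -/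

section ModuleAlgebra
open Module TensorProduct

variable {B S : Type*} [AddCommGroup B] [AddCommGroup S] (ι : B →ₗ[ℤ] S)

/-- The cokernel of the restriction map `Hom(S, R) → Hom(B, R)` along `ι : B → S`. If `B` and `S` are
free and `ι` is injective, then this is `Ext(S / B, R)`. -/
abbrev HomCoker (R : Type*) [CommRing R] : Type _ :=
  (B →ₗ[ℤ] R) ⧸ LinearMap.range (LinearMap.lcomp R R ι)

/-- The kernel of `ι` modulo `p`. -/
abbrev modKer (p : ℕ) : Submodule (ZMod p) (ZMod p ⊗[ℤ] B) :=
  LinearMap.ker (ι.baseChange (ZMod p))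

/-- A homomorphism on `B` to a `ZMod p`-module induces one on the kernel of `ι` modulo `p`. -/
noncomputable def homToModKer (p : ℕ) {V : Type*} [AddCommGroup V] [Module (ZMod p) V]
    (g : B →ₗ[ℤ] V) : modKer ι p →ₗ[ZMod p] V :=
  (g.liftBaseChange (ZMod p)) ∘ₗ (modKer ι p).subtype

variable {p : ℕ} {V : Type*} [AddCommGroup V] [Module (ZMod p) V]

lemma homToModKer_add (g g' : B →ₗ[ℤ] V) :
    homToModKer ι p (g + g') = homToModKer ι p g + homToModKer ι p g' := by
  simp [homToModKer, LinearMap.liftBaseChange, LinearMap.add_comp]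

lemma homToModKer_sub (g g' : B →ₗ[ℤ] V) :
    homToModKer ι p (g - g') = homToModKer ι p g - homToModKer ι p g' := by
  simp [homToModKer, LinearMap.liftBaseChange, LinearMap.sub_comp]

lemma homToModKer_sum {α : Type*} (s : Finset α) (g : α → B →ₗ[ℤ] V) :
    homToModKer ι p (∑ i ∈ s, g i) = ∑ i ∈ s, homToModKer ι p (g i) :=
  map_sum (AddMonoidHom.mk' (homToModKer ι p (V := V)) (homToModKer_add ι)) g s

lemma homToModKer_comp_left {W : Type*} [AddCommGroup W] [Module (ZMod p) W] (m : V →ₗ[ZMod p] W)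
    (g : B →ₗ[ℤ] V) : homToModKer ι p (m.restrictScalars ℤ ∘ₗ g) = m ∘ₗ homToModKer ι p g := by
  have : (m.restrictScalars ℤ ∘ₗ g).liftBaseChange (ZMod p) = m ∘ₗ g.liftBaseChange (ZMod p) := by
    ext x
    simp
  rw [homToModKer, this]
  rfl

lemma homToModKer_comp_right (u : S →ₗ[ℤ] V) : homToModKer ι p (u ∘ₗ ι) = 0 := by
  have h : (u ∘ₗ ι).liftBaseChange (ZMod p) =
      u.liftBaseChange (ZMod p) ∘ₗ ι.baseChange (ZMod p) := by
    ext x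
    simp
  refine LinearMap.ext fun x ↦ ?_
  have hx : ι.baseChange (ZMod p) x.1 = 0 := x.2
  change (u ∘ₗ ι).liftBaseChange (ZMod p) x.1 = 0
  rw [h, LinearMap.comp_apply, hx, map_zero]

variable [Fact p.Prime]

/-- A map from `B` to `V` is a linear map on `B/p`; if it kills the kernel of `ι` modulo `p`, it
factors through `S/p`. With `homToModKer_comp_right` and `homToModKer_surjective`, the cokernel of
restriction into `V` is `Hom(modKer ι p, V)`. -/
lemma exists_extension_of_homToModKer_eq_zero (g : B →ₗ[ℤ] V) (hg : homToModKer ι p g = 0) :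
    ∃ u : S →ₗ[ℤ] V, u ∘ₗ ι = g := by
  obtain ⟨h, hh⟩ := LinearMap.exists_comp_eq_of_ker_le (ι.baseChange (ZMod p))
    (g.liftBaseChange (ZMod p)) (fun x hx ↦ LinearMap.congr_fun hg ⟨x, hx⟩)
  refine ⟨h.restrictScalars ℤ ∘ₗ TensorProduct.mk ℤ (ZMod p) S 1, LinearMap.ext fun b ↦ ?_⟩
  have := LinearMap.congr_fun hh (1 ⊗ₜ b)
  simp only [LinearMap.comp_apply, LinearMap.baseChange_tmul, LinearMap.liftBaseChange_tmul,
    one_smul] at this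
  exact this

lemma homToModKer_surjective :
    Function.Surjective (homToModKer ι p : (B →ₗ[ℤ] V) → (modKer ι p →ₗ[ZMod p] V)) := by
  intro f
  obtain ⟨h, hh⟩ := LinearMap.exists_extend f
  refine ⟨(LinearMap.liftBaseChangeEquiv (ZMod p)).symm h, ?_⟩
  rw [homToModKer, LinearMap.liftBaseChange, LinearEquiv.apply_symm_apply, hh]

/-- If `ι` modulo `p` has finite kernel, then, up to homomorphisms extending along `ι`, every
homomorphism on `B` to a `ZMod p`-module comes from finitely many integral functionals. -/
lemma exists_eq_sum_add_comp [Module.Projective ℤ B] [Module.Finite (ZMod p) (modKer ι p)]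
    (v : B →ₗ[ℤ] V) : ∃ (n : ℕ) (G : Fin n → (B →ₗ[ℤ] ℤ)) (x : Fin n → V) (u : S →ₗ[ℤ] V),
      ∀ b, v b = ∑ i, G i b • x i + u (ι b) := by
  classical
  let e := Module.finBasis (ZMod p) (modKer ι p)
  choose g hg using fun i ↦ homToModKer_surjective ι (p := p) (e.coord i)
  choose G hG using fun i ↦ Module.projective_lifting_property
    (Int.castAddHom (ZMod p)).toIntLinearMap (g i) (ZMod.intCast_surjective)
  -- The sum `w` agrees with `v` on the basis `e` of the kernel modulo `p`, so `v - w` extends along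
  -- `ι`.
  let x := fun i ↦ homToModKer ι p v (e i)
  let w : B →ₗ[ℤ] V := ∑ i, (LinearMap.toSpanSingleton (ZMod p) V (x i)).restrictScalars ℤ ∘ₗ g i
  have hw : homToModKer ι p (v - w) = 0 := by
    rw [homToModKer_sub, sub_eq_zero]
    refine e.ext fun j ↦ ?_
    rw [homToModKer_sum, LinearMap.sum_apply, Finset.sum_eq_single j]
    · rw [homToModKer_comp_left, hg]
      simp [x]
    · intro i _ hij
      rw [homToModKer_comp_left, hg]
      simp [hij.symm]
    · simp
  obtain ⟨u, hu⟩ := exists_extension_of_homToModKer_eq_zero ι _ hw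
  refine ⟨_, G, x, u, fun b ↦ ?_⟩
  have h1 : u (ι b) = v b - w b := LinearMap.congr_fun hu b
  have h2 : w b = ∑ i, G i b • x i := by
    simp only [w, LinearMap.sum_apply]
    refine Finset.sum_congr rfl fun i _ ↦ ?_
    have h3 : g i b = ((G i b : ℤ) : ZMod p) := (LinearMap.congr_fun (hG i) b).symm
    simp [h3, Int.cast_smul_eq_zsmul]
  rw [h1, h2, add_sub_cancel]

end ModuleAlgebra

/-! ### Lifting and dividing homomorphisms that vanish on `B`. -/

section Reduction

open Module

variable {B S : Type*} [AddCommGroup B] [AddCommGroup S] (ι : B →ₗ[ℤ] S) {p : ℕ}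
  {R A : Type*} [CommRing R] [CommRing A]

/-- Reduction along `f` maps `HomCoker ι R` onto `Hom(modKer ι p, A)`, since `B` is projective; the
latter is therefore finite over `A`. -/
lemma finite_modKer [Fact p.Prime] [Module.Projective ℤ B] [Nontrivial A] (f : R →+* A)
    (hf : Function.Surjective f) (hp : (p : A) = 0) [Module.Finite R (HomCoker ι R)] :
    Module.Finite (ZMod p) (modKer ι p) := by
  have : CharP A p := (CharP.charP_iff_prime_eq_zero Fact.out).2 hp
  let := ZMod.algebra A p
  let θ : (B →ₗ[ℤ] R) →ₛₗ[f] (modKer ι p →ₗ[ZMod p] A) :=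
    { toFun g := homToModKer ι p (f.toAddMonoidHom.toIntLinearMap ∘ₗ g)
      map_add' g g' := by rw [LinearMap.comp_add, homToModKer_add]
      map_smul' r g := by
        refine Eq.trans ?_ (homToModKer_comp_left ι (LinearMap.mulLeft (ZMod p) (f r))
          (f.toAddMonoidHom.toIntLinearMap ∘ₗ g))
        congr 1
        ext b
        simp }
  have hθ : Function.Surjective θ := fun y ↦ by
    obtain ⟨g, rfl⟩ := homToModKer_surjective ι y
    obtain ⟨g', rfl⟩ := Module.projective_lifting_property f.toAddMonoidHom.toIntLinearMap g hf
    exact ⟨g', rfl⟩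
  let θ' : HomCoker ι R →ₛₗ[f] (modKer ι p →ₗ[ZMod p] A) := Submodule.liftQ _ θ (by
    rintro _ ⟨u, rfl⟩
    exact homToModKer_comp_right ι (f.toAddMonoidHom.toIntLinearMap ∘ₗ u))
  have : Module.Finite A (modKer ι p →ₗ[ZMod p] A) :=
    Module.Finite.of_surjective θ' fun y ↦ (hθ y).imp' (Submodule.mkQ _) fun g hg ↦ hg
  exact Module.Finite.of_finite_hom (A := A)

/-- Quotients by a zero divisor `r` are not unique; projectivity of `B` chooses them additively. -/
lemma exists_eq_mul_of_forall_exists [Module.Projective ℤ B] (r : R) (g : B →ₗ[ℤ] R)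
    (hg : ∀ b, ∃ s, g b = r * s) : ∃ h : B →ₗ[ℤ] R, ∀ b, g b = r * h b := by
  let m := LinearMap.mulLeft ℤ r
  obtain ⟨h, hh⟩ := Module.projective_lifting_property m.rangeRestrict
    (g.codRestrict (LinearMap.range m) fun b ↦ (hg b).imp fun _ hs ↦ hs.symm)
    m.surjective_rangeRestrict
  exact ⟨h, fun b ↦ (congrArg Subtype.val (LinearMap.congr_fun hh b)).symm⟩

/-- If the cokernel of the restriction map `Hom(S, R) → Hom(B, R)` is flat, then a linear combination
of functionals that extends along `ι` is equal to one whose functionals extend. -/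
lemma exists_extension_of_sum_mul_eq [Module.Flat R (HomCoker ι R)] {n : ℕ} (x : Fin n → R)
    (G : Fin n → (B →ₗ[ℤ] R)) (u : S →ₗ[ℤ] R) (h : ∀ b, ∑ i, x i * G i b = u (ι b)) :
    ∃ w : Fin n → (S →ₗ[ℤ] R), ∀ b, ∑ i, x i * G i b = ∑ i, x i * w i (ι b) := by
  let N := LinearMap.range (LinearMap.lcomp R R ι)
  have h0 : ∑ i, x i • N.mkQ (G i) = 0 := by
    have h1 : N.mkQ (∑ i, x i • G i) = 0 :=
      (Submodule.Quotient.mk_eq_zero _).2 ⟨u, LinearMap.ext fun b ↦ by simp [h]⟩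
    simpa only [map_sum, map_smul] using h1
  -- Equational criterion for flatness: `∑ i, x i * a i j = 0`, so subtracting `∑ j, a i j • Y j`
  -- from `G i` leaves the total unchanged and makes each term extendable.
  obtain ⟨k, a, y, hy, ha⟩ := Flat.isTrivialRelation_of_sum_smul_eq_zero h0
  choose Y hY using fun j ↦ N.mkQ_surjective (y j)
  have hG : ∀ i, G i - ∑ j, a i j • Y j ∈ N := by
    intro i
    refine (Submodule.Quotient.mk_eq_zero _).1 ?_
    change N.mkQ _ = 0
    rw [map_sub, map_sum, sub_eq_zero]
    refine (hy i).trans (Finset.sum_congr rfl fun j _ ↦ ?_)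
    rw [map_smul, hY]
  choose w hw using hG
  refine ⟨w, fun b ↦ ?_⟩
  have hb : ∀ i, w i (ι b) = G i b - ∑ j, a i j * Y j b := fun i ↦ by
    simpa using LinearMap.congr_fun (hw i) b
  have h1 : ∑ i, x i * ∑ j, a i j * Y j b = 0 := by
    simp only [Finset.mul_sum, ← mul_assoc]
    rw [Finset.sum_comm]
    simp only [← Finset.sum_mul, ha, zero_mul, Finset.sum_const_zero]
  simp only [hb, mul_sub, Finset.sum_sub_distrib, h1, sub_zero]

variable (f : R →+* A)

lemma exists_lift_of_comp_eq_zero [Module.Projective ℤ B] [Module.Projective ℤ S]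
    [Module.Flat R (HomCoker ι R)] (hf : Function.Surjective f)
    (hk : ∀ r, f r = 0 ↔ ∃ s, r = p * s) (g : S →ₗ[ℤ] A) (hg : g ∘ₗ ι = 0) :
    ∃ g' : S →ₗ[ℤ] R, g' ∘ₗ ι = 0 ∧ ∀ s, f (g' s) = g s := by
  obtain ⟨g₁, rfl⟩ := Module.projective_lifting_property f.toAddMonoidHom.toIntLinearMap g hf
  obtain ⟨h, hh⟩ := exists_eq_mul_of_forall_exists (p : R) (g₁ ∘ₗ ι) fun b ↦
    (hk _).1 (LinearMap.congr_fun hg b)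
  obtain ⟨w, hw⟩ := exists_extension_of_sum_mul_eq ι (fun _ : Fin 1 ↦ (p : R)) (fun _ ↦ h) g₁
    fun b ↦ by simpa using (hh b).symm
  refine ⟨g₁ - LinearMap.mulLeft ℤ (p : R) ∘ₗ w 0, LinearMap.ext fun b ↦ ?_, fun s ↦ ?_⟩
  · have h1 : (p : R) * h b = p * w 0 (ι b) := by simpa using hw b
    have h2 : g₁ (ι b) = p * h b := hh b
    simp [h1, h2]
  · have : f p = 0 := (hk _).2 ⟨1, by simp⟩
    simp only [map_natCast] at this
    simp [this]

lemma exists_eq_mul_of_comp_eq_zero [Fact p.Prime] [Module.Projective ℤ B] [Module.Projective ℤ S]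
    [Module.Flat R (HomCoker ι R)] [Module.Finite R (HomCoker ι R)] (hf : Function.Surjective f)
    (hk : ∀ r, f r = 0 ↔ ∃ s, r = p * s) (g : S →ₗ[ℤ] R) (hg : g ∘ₗ ι = 0)
    (hg' : ∀ s, f (g s) = 0) :
    ∃ g' : S →ₗ[ℤ] R, g' ∘ₗ ι = 0 ∧ ∀ s, g s = p * g' s := by
  obtain ⟨v, hv⟩ := exists_eq_mul_of_forall_exists (p : R) g fun s ↦ (hk _).1 (hg' s)
  have hvp : ∀ b, (p : R) * v (ι b) = 0 := fun b ↦ (hv _).symm.trans (LinearMap.congr_fun hg b)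
  rcases subsingleton_or_nontrivial A with hA | hA
  -- If `A = 0` then `p` is a unit in `R`, so `v` itself vanishes on `B`.
  · obtain ⟨s, hs⟩ := (hk 1).1 (Subsingleton.elim _ _)
    refine ⟨v, LinearMap.ext fun b ↦ ?_, hv⟩
    calc v (ι b) = (p * s) * v (ι b) := by rw [← hs, one_mul]
      _ = s * (p * v (ι b)) := by ring
      _ = 0 := by rw [hvp, mul_zero]
  have hp : (p : A) = 0 := by simpa using (hk p).2 ⟨1, by simp⟩
  have := finite_modKer ι f hf hp
  let I := LinearMap.ker (LinearMap.mulLeft ℤ (p : R))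
  let : Module (ZMod p) I := AddCommGroup.zmodModule fun x ↦ Subtype.ext <| by
    have : (p : R) * x = 0 := x.2
    simpa using this
  obtain ⟨n, G, x, u, hu⟩ := exists_eq_sum_add_comp ι (p := p) ((v ∘ₗ ι).codRestrict I hvp)
  have hx : ∀ i, (p : R) * x i = 0 := fun i ↦ (x i).2
  have hup : ∀ s, (p : R) * u s = 0 := fun s ↦ (u s).2
  have hu' : ∀ b, v (ι b) = ∑ i, (x i : R) * (G i b : ℤ) + u (ι b) := by
    intro b
    have h : v (ι b) = (∑ i, G i b • x i + u (ι b) : I) := congrArg Subtype.val (hu b)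
    rw [h]
    simp only [Submodule.coe_add, Submodule.coe_sum, Submodule.coe_smul, zsmul_eq_mul, mul_comm]
  obtain ⟨w, hw⟩ := exists_extension_of_sum_mul_eq ι (fun i ↦ (x i : R))
    (fun i ↦ (Int.castAddHom R).toIntLinearMap ∘ₗ G i) (v - I.subtype ∘ₗ u) fun b ↦ by
      simp [hu']
  -- Both corrections are killed by `p`, so multiplying by `p` still gives `g`; on `B` they cancel
  -- `v`.
  refine ⟨v - I.subtype ∘ₗ u - ∑ i, LinearMap.mulLeft ℤ (x i : R) ∘ₗ w i,
    LinearMap.ext fun b ↦ ?_, fun s ↦ ?_⟩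
  · have h := hw b
    simp only [LinearMap.comp_apply, AddMonoidHom.coe_toIntLinearMap, Int.coe_castAddHom] at h
    simp [hu', h]
  · simp [mul_sub, hv, hup, Finset.mul_sum, ← mul_assoc, hx]

end Reduction

/-! ### Simplicial chains and their duality with cochains. -/

namespace SSetCochain

open CategoryTheory Opposite
open scoped Simplicial

section Chains

variable (k : Type*) [CommRing k] (X : SSet.{u})

/-- The boundary map of the simplicial chains with coefficients in `k`. -/
noncomputable def boundary (n : ℕ) : (X _⦋n + 1⦌ →₀ k) →ₗ[k] (X _⦋n⦌ →₀ k) :=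
  Finsupp.linearCombination k fun σ ↦
    ∑ i : Fin (n + 2), (-1 : k) ^ (i : ℕ) • Finsupp.single (X.δ i σ) 1

variable {k X}

lemma boundary_single (n : ℕ) (σ : X _⦋n + 1⦌) : boundary k X n (Finsupp.single σ 1) =
    ∑ i : Fin (n + 2), (-1 : k) ^ (i : ℕ) • Finsupp.single (X.δ i σ) 1 := by
  simp [boundary]

lemma boundary_boundary (n : ℕ) : boundary k X n ∘ₗ boundary k X (n + 1) = 0 := by
  refine Finsupp.lhom_ext' fun σ ↦ LinearMap.ext_ring ?_
  change boundary k X n (boundary k X (n + 1) (Finsupp.single σ 1)) = 0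
  simp only [boundary_single, map_sum, map_smul, Finset.smul_sum, smul_smul]
  rw [← Finset.sum_product', Finset.univ_product_univ]
  -- The simplicial identity pairs the terms in `s` with those outside it, with opposite signs.
  let s : Finset (Fin (n + 3) × Fin (n + 2)) := {ij | (ij.1 : ℕ) ≤ (ij.2 : ℕ)}
  rw [← Finset.sum_add_sum_compl s, ← eq_neg_iff_add_eq_zero, ← Finset.sum_neg_distrib]
  refine Finset.sum_bij (fun ij hij ↦ (ij.2.succ, Fin.castLT ij.1
    (lt_of_le_of_lt (Finset.mem_filter.mp hij).right (Fin.is_lt ij.2)))) ?_ ?_ ?_ ?_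
  · intro ij hij
    simp only [s, Finset.compl_filter, Finset.mem_filter_univ, Fin.val_succ, Fin.val_castLT] at hij ⊢
    omega
  · rintro ⟨i, j⟩ hij ⟨i', j'⟩ hij' h
    simp only [Prod.mk.injEq, Fin.ext_iff, Fin.val_succ, Fin.val_castLT] at h ⊢
    omega
  · rintro ⟨i, j⟩ hij
    simp only [s, Finset.compl_filter, Finset.mem_filter_univ, not_le] at hij
    refine ⟨(j.castSucc, ⟨i - 1, by omega⟩), ?_, ?_⟩
    · simp only [s, Finset.mem_filter_univ, Fin.val_castSucc]
      omega
    · refine Prod.ext (Fin.ext ?_) (Fin.ext rfl)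
      change (i : ℕ) - 1 + 1 = i
      omega
  · rintro ⟨i, j⟩ hij
    have h : X.δ j (X.δ i σ) = X.δ (Fin.castLT i
        (lt_of_le_of_lt (Finset.mem_filter.mp hij).right (Fin.is_lt j))) (X.δ j.succ σ) := by
      rw [← ConcreteCategory.comp_apply, ← ConcreteCategory.comp_apply,
        SimplicialObject.δ_comp_δ'']
      simpa [s, Fin.le_def] using hij
    rw [← neg_smul, h]
    congr 1
    simp only [Fin.val_succ, Fin.val_castLT]
    ring

/-- Cochains are linear maps on chains over any base `k` of `A`; below, `k` is `ℤ` for lifting and a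
field for duality. -/
lemma linearCombination_d {A : Type*} [CommRing A] [Algebra k A] (n : ℕ) (φ : Cochain A X n) :
    Finsupp.linearCombination k (d A X n φ) = Finsupp.linearCombination k φ ∘ₗ boundary k X n := by
  refine Finsupp.lhom_ext' fun σ ↦ LinearMap.ext_ring ?_
  simp [boundary_single, d, Algebra.smul_def]

lemma mem_Z_iff {A : Type*} [CommRing A] [Algebra k A] (n : ℕ) (φ : Cochain A X n) :
    φ ∈ Z A X n ↔ Finsupp.linearCombination k φ ∘ₗ boundary k X n = 0 := by
  rw [← linearCombination_d]
  constructor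
  · intro h
    have h' : d A X n φ = 0 := h
    rw [h', Finsupp.linearCombination_zero]
  · intro h
    change d A X n φ = 0
    funext σ
    simpa using LinearMap.congr_fun h (Finsupp.single σ 1)

lemma d_eq_of_comp_boundary {A : Type*} [CommRing A] [Algebra k A] (n : ℕ)
    (u : (X _⦋n⦌ →₀ k) →ₗ[k] A) (σ : X _⦋n + 1⦌) :
    d A X n (fun τ ↦ u (Finsupp.single τ 1)) σ = u (boundary k X n (Finsupp.single σ 1)) := by
  simp only [boundary_single, d, map_sum, map_smul, Algebra.smul_def]
  simp

lemma linearCombination_single_one {A : Type*} [CommRing A] [Algebra k A] (n : ℕ)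
    (u : (X _⦋n⦌ →₀ k) →ₗ[k] A) :
    Finsupp.linearCombination k (fun τ ↦ u (Finsupp.single τ 1)) = u := by
  refine Finsupp.lhom_ext' fun σ ↦ LinearMap.ext_ring ?_
  simp

end Chains

/-! ### The `Ext` summand of cohomology. -/

section IntegralBoundaries

variable (X : SSet.{u})

/-- The integral boundaries in degree `n`. -/
noncomputable abbrev Bd (n : ℕ) : Submodule ℤ (X _⦋n⦌ →₀ ℤ) := LinearMap.range (boundary ℤ X n)

instance projective_Bd (n : ℕ) : Module.Projective ℤ (Bd X n) :=
  have := Submodule.free_of_finsupp (Bd X n)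
  Module.Projective.of_free

variable (R : Type v) [CommRing R]

/-- The map from `Ext` of the integral homology to cohomology. -/
noncomputable def homCokerToH (n : ℕ) : HomCoker (Bd X n).subtype R →ₗ[R] H R X (n + 1) :=
  Submodule.liftQ _
    (mkH ∘ₗ
      { toFun g := ⟨fun σ ↦ g ((boundary ℤ X n).rangeRestrict (Finsupp.single σ 1)), by
          rw [mem_Z_iff (k := ℤ)]
          refine Finsupp.lhom_ext' fun σ ↦ LinearMap.ext_ring ?_
          have h := linearCombination_single_one (n + 1) (g ∘ₗ (boundary ℤ X n).rangeRestrict)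
          have h' : (boundary ℤ X n).rangeRestrict (boundary ℤ X (n + 1) (Finsupp.single σ 1)) =
            0 := Subtype.ext (LinearMap.congr_fun (boundary_boundary n) (Finsupp.single σ 1))
          refine (LinearMap.congr_fun h (boundary ℤ X (n + 1) (Finsupp.single σ 1))).trans ?_
          rw [LinearMap.comp_apply, h', map_zero]
          rfl⟩
        map_add' _ _ := rfl
        map_smul' _ _ := rfl })
    (by
      rintro _ ⟨u, rfl⟩
      exact (mkH_eq_zero _).2 ⟨fun τ ↦ u (Finsupp.single τ 1),
        funext fun σ ↦ d_eq_of_comp_boundary n u σ⟩)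

/-- The restriction of cochains to a complement of the integral cycles, on cohomology. -/
noncomputable def hToHomCoker (n : ℕ) (s : Bd X n →ₗ[ℤ] (X _⦋n + 1⦌ →₀ ℤ))
    (hs : boundary ℤ X n ∘ₗ s = (Bd X n).subtype) :
    H R X (n + 1) →ₗ[R] HomCoker (Bd X n).subtype R :=
  Submodule.liftQ _
    (Submodule.mkQ _ ∘ₗ LinearMap.lcomp R R s ∘ₗ
      (Finsupp.llift R ℤ R (X _⦋n + 1⦌)).toLinearMap ∘ₗ (Z R X (n + 1)).subtype)
    (by
      rintro ⟨_, hz⟩ ⟨χ, rfl⟩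
      refine (Submodule.Quotient.mk_eq_zero _).2 ⟨Finsupp.linearCombination ℤ χ, ?_⟩
      rw [← hs]
      exact congrArg (· ∘ₗ s) (linearCombination_d n χ).symm)

/-- Boundaries are projective, so the boundary map onto them has a section `s`. Pulling a functional
back along the boundary map and then along `s` returns it. -/
lemma exists_retraction (n : ℕ) : ∃ r : H R X (n + 1) →ₗ[R] HomCoker (Bd X n).subtype R,
    r ∘ₗ homCokerToH X R n = LinearMap.id := by
  obtain ⟨s, hs⟩ := Module.projective_lifting_property (boundary ℤ X n).rangeRestrict
    LinearMap.id (LinearMap.surjective_rangeRestrict _)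
  refine ⟨hToHomCoker X R n s (LinearMap.ext fun b ↦ congrArg Subtype.val (LinearMap.congr_fun hs b)),
    LinearMap.ext fun g ↦ ?_⟩
  obtain ⟨g, rfl⟩ := Submodule.mkQ_surjective _ g
  refine congrArg (Submodule.mkQ _) ?_
  change Finsupp.linearCombination ℤ (fun σ ↦ (g ∘ₗ (boundary ℤ X n).rangeRestrict)
    (Finsupp.single σ 1)) ∘ₗ s = g
  rw [linearCombination_single_one, LinearMap.comp_assoc, hs, LinearMap.comp_id]

instance flat_homCoker (n : ℕ) [Module.Flat R (H R X (n + 1))] :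
    Module.Flat R (HomCoker (Bd X n).subtype R) :=
  (exists_retraction X R n).elim fun r hr ↦ Module.Flat.of_retract (homCokerToH X R n) r hr

instance finite_homCoker (n : ℕ) [Module.Finite R (H R X (n + 1))] :
    Module.Finite R (HomCoker (Bd X n).subtype R) :=
  (exists_retraction X R n).elim fun r hr ↦
    Module.Finite.of_surjective r fun x ↦ ⟨_, LinearMap.congr_fun hr x⟩

end IntegralBoundaries

/-! ### Reduction of coefficients on cohomology. -/

section Reduction

variable {X : SSet.{u}} {R : Type v} [CommRing R] {A : Type w} [CommRing A] {p : ℕ} (f : R →+* A)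

lemma comp_Bd_subtype_eq_zero_iff (n : ℕ) (φ : Cochain A X n) :
    Finsupp.linearCombination ℤ φ ∘ₗ (Bd X n).subtype = 0 ↔ φ ∈ Z A X n := by
  rw [mem_Z_iff (k := ℤ)]
  constructor
  · intro h
    exact LinearMap.ext fun x ↦ LinearMap.congr_fun h ⟨_, x, rfl⟩
  · rintro h
    refine LinearMap.ext fun ⟨_, x, hx⟩ ↦ ?_
    subst hx
    exact LinearMap.congr_fun h x

theorem coeffH_surjective (n : ℕ) [Module.Flat R (H R X (n + 1))] (hf : Function.Surjective f)
    (hk : ∀ r, f r = 0 ↔ ∃ s, r = p * s) : Function.Surjective (coeffH f X n) := by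
  intro y
  obtain ⟨⟨φ, hφ⟩, rfl⟩ := mkH_surjective y
  obtain ⟨g, hg, hgf⟩ := exists_lift_of_comp_eq_zero (Bd X n).subtype f hf hk
    (Finsupp.linearCombination ℤ φ) ((comp_Bd_subtype_eq_zero_iff n φ).2 hφ)
  refine ⟨mkH ⟨fun σ ↦ g (Finsupp.single σ 1), ?_⟩, congrArg mkH (Subtype.ext (funext fun σ ↦ ?_))⟩
  · rw [← comp_Bd_subtype_eq_zero_iff, linearCombination_single_one, hg]
  · exact (hgf _).trans (by simp)

theorem exists_eq_smul_of_coeffH_eq_zero (n : ℕ) [Fact p.Prime] [Module.Flat R (H R X (n + 1))]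
    [Module.Finite R (H R X (n + 1))] (hf : Function.Surjective f)
    (hk : ∀ r, f r = 0 ↔ ∃ s, r = p * s) (x : H R X n) (hx : coeffH f X n x = 0) :
    ∃ y, x = (p : R) • y := by
  obtain ⟨⟨φ, hφ⟩, rfl⟩ := mkH_surjective x
  have hB : coeffCochain f X n φ ∈ B A X n := (mkH_eq_zero _).1 hx
  -- Lifting a primitive of the reduced cocycle gives a coboundary `β` such that `φ - β` reduces to
  -- zero as a cochain. In degree `0` there are no nonzero coboundaries and `β = 0`.
  obtain ⟨β, hβ, hβφ⟩ : ∃ β ∈ B R X n, coeffCochain f X n β = coeffCochain f X n φ := by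
    cases n with
    | zero =>
      have h0 : coeffCochain f X 0 φ = 0 := hB
      exact ⟨0, zero_mem _, by rw [h0, map_zero]⟩
    | succ n =>
      obtain ⟨χ, hχ⟩ := hB
      choose χ' hχ' using fun σ ↦ hf (χ σ)
      refine ⟨d R X n χ', ⟨χ', rfl⟩, ?_⟩
      rw [← hχ, ← d_coeffCochain]
      exact congrArg _ (funext hχ')
  have hBZ : B R X n ≤ Z R X n := by
    cases n with
    | zero => exact bot_le
    | succ n =>
      rintro _ ⟨χ, rfl⟩
      rw [mem_Z_iff (k := ℤ), linearCombination_d, LinearMap.comp_assoc, boundary_boundary,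
        LinearMap.comp_zero]
  obtain ⟨g, hg, hgf⟩ := exists_eq_mul_of_comp_eq_zero (Bd X n).subtype f hf hk
    (Finsupp.linearCombination ℤ (φ - β))
    ((comp_Bd_subtype_eq_zero_iff n _).2 (sub_mem hφ (hBZ hβ))) (by
      intro s
      have h : f.toAddMonoidHom.toIntLinearMap ∘ₗ Finsupp.linearCombination ℤ (φ - β) = 0 := by
        refine Finsupp.lhom_ext' fun σ ↦ LinearMap.ext_ring ?_
        have h1 : f (β σ) = f (φ σ) := congrFun hβφ σ
        simp [h1]
      exact LinearMap.congr_fun h s)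
  refine ⟨mkH ⟨fun σ ↦ g (Finsupp.single σ 1), ?_⟩, ?_⟩
  · rw [← comp_Bd_subtype_eq_zero_iff, linearCombination_single_one, hg]
  · rw [← sub_eq_zero, ← map_smul, ← map_sub, mkH_eq_zero]
    convert hβ using 1
    funext σ
    have h := hgf (Finsupp.single σ 1)
    simp only [Finsupp.linearCombination_single, one_smul, Pi.sub_apply] at h
    change φ σ - p * g (Finsupp.single σ 1) = β σ
    rw [← h, sub_sub_cancel]

end Reduction

end SSetCochain

namespace SSetCochain

open CategoryTheory Opposite TensorProduct
open scoped Simplicial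

/-! ### Change of coefficients as a map from the tensor product. -/

section CoefficientTensor

variable (R : Type v) [CommRing R] (S : Type w) [CommRing S] [Algebra R S] (X : SSet.{u})

/-- The natural map `S ⊗ Hⁿ(X; R) → Hⁿ(X; S)`. -/
noncomputable def coeffTensor (n : ℕ) : S ⊗[R] H R X n →ₗ[S] H S X n :=
  letI : Module R (H S X n) := Module.compHom _ (algebraMap R S)
  haveI : IsScalarTower R S (H S X n) := ⟨fun r s x ↦ by
    rw [Algebra.smul_def, mul_smul]
    rfl⟩
  LinearMap.liftBaseChange S
    { toFun := coeffH (algebraMap R S) X n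
      map_add' := map_add _
      map_smul' := map_smulₛₗ (coeffH (algebraMap R S) X n) }

lemma coeffTensor_tmul (n : ℕ) (a : S) (x : H R X n) :
    coeffTensor R S X n (a ⊗ₜ x) = a • coeffH (algebraMap R S) X n x := rfl

variable {R S X}

/-- For a quotient by a principal ideal `(r)`, the natural map is bijective as soon as `Hⁿ(X; R)`
surjects onto `Hⁿ(X; S)` with kernel the multiples of `r`. -/
lemma coeffTensor_bijective_of_surjective (n : ℕ) (hS : Function.Surjective (algebraMap R S)) (r : R)
    (hr : algebraMap R S r = 0) (h : Function.Surjective (coeffH (algebraMap R S) X n))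
    (hker : ∀ x : H R X n, coeffH (algebraMap R S) X n x = 0 → ∃ y, x = r • y) :
    Function.Bijective (coeffTensor R S X n) := by
  have hmk : ∀ t : S ⊗[R] H R X n, ∃ x : H R X n, t = 1 ⊗ₜ x := by
    intro t
    induction t with
    | zero => exact ⟨0, (tmul_zero _ _).symm⟩
    | tmul a x =>
      obtain ⟨b, rfl⟩ := hS a
      exact ⟨b • x, by rw [← smul_tmul, Algebra.smul_def, mul_one]⟩
    | add t t' ht ht' =>
      obtain ⟨x, rfl⟩ := ht
      obtain ⟨x', rfl⟩ := ht'
      exact ⟨x + x', (tmul_add _ _ _).symm⟩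
  constructor
  · refine (injective_iff_map_eq_zero _).2 fun t ht ↦ ?_
    obtain ⟨x, rfl⟩ := hmk t
    rw [coeffTensor_tmul, one_smul] at ht
    obtain ⟨y, rfl⟩ := hker x ht
    rw [← smul_tmul, Algebra.smul_def, hr, zero_mul, zero_tmul]
  · intro y
    obtain ⟨x, rfl⟩ := h y
    exact ⟨1 ⊗ₜ x, by rw [coeffTensor_tmul, one_smul]⟩

end CoefficientTensor

/-! ### Duality of homology and cohomology over a field. -/

section Field

variable (k : Type*) [Field k] (X : SSet.{u})

/-- The cycles of degree `n` with coefficients in `k`. -/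
noncomputable def cycles (n : ℕ) : Submodule k (X _⦋n⦌ →₀ k) :=
  match n with
  | 0 => ⊤
  | n + 1 => LinearMap.ker (boundary k X n)

/-- The homology with coefficients in `k`, as a subspace of the chains modulo boundaries. -/
noncomputable abbrev Homology (n : ℕ) :
    Submodule k ((X _⦋n⦌ →₀ k) ⧸ LinearMap.range (boundary k X n)) :=
  (cycles k X n).map (Submodule.mkQ _)

variable {k X}

variable {A : Type*} [CommRing A] [Algebra k A]

/-- Over a field, a functional that vanishes on the kernel of the boundary map factors through that
map. In degree `0` all chains are cycles, matching the zero module of coboundaries. -/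
lemma mem_B_iff (n : ℕ) (φ : Cochain A X n) :
    φ ∈ B A X n ↔ ∀ x ∈ cycles k X n, Finsupp.linearCombination k φ x = 0 := by
  cases n with
  | zero =>
    constructor
    · intro h x _
      have h0 : φ = 0 := h
      rw [h0, Finsupp.linearCombination_zero, LinearMap.zero_apply]
    · intro h
      change φ = 0
      funext σ
      simpa using h (Finsupp.single σ 1) Submodule.mem_top
  | succ n =>
    constructor
    · rintro ⟨χ, rfl⟩ x hx
      have hx' : boundary k X n x = 0 := hx
      rw [linearCombination_d, LinearMap.comp_apply, hx', map_zero]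
    · intro h
      obtain ⟨u, hu⟩ := LinearMap.exists_comp_eq_of_ker_le (boundary k X n)
        (Finsupp.linearCombination k φ) h
      refine ⟨fun τ ↦ u (Finsupp.single τ 1), funext fun σ ↦ ?_⟩
      rw [d_eq_of_comp_boundary]
      simpa using LinearMap.congr_fun hu (Finsupp.single σ 1)

variable (k X A)

/-- The evaluation of cocycles on homology classes. -/
noncomputable def evalZ (n : ℕ) : Z A X n →ₗ[A] (Homology k X n →ₗ[k] A) where
  toFun φ := Submodule.liftQ _ (Finsupp.linearCombination k φ.1) (by
    rintro _ ⟨x, rfl⟩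
    exact LinearMap.congr_fun ((mem_Z_iff n φ.1).1 φ.2) x) ∘ₗ (Homology k X n).subtype
  map_add' φ ψ := by
    refine LinearMap.ext ?_
    rintro ⟨_, x, hx, rfl⟩
    exact LinearMap.congr_fun (map_add (Finsupp.llift A k A (X _⦋n⦌)) φ.1 ψ.1) x
  map_smul' a φ := by
    refine LinearMap.ext ?_
    rintro ⟨_, x, hx, rfl⟩
    exact LinearMap.congr_fun (map_smul (Finsupp.llift A k A (X _⦋n⦌)) a φ.1) x

lemma evalZ_eq_zero_iff (n : ℕ) (φ : Z A X n) : evalZ k X A n φ = 0 ↔ φ.1 ∈ B A X n := by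
  rw [mem_B_iff (k := k)]
  constructor
  · intro h x hx
    exact LinearMap.congr_fun h ⟨_, x, hx, rfl⟩
  · intro h
    refine LinearMap.ext ?_
    rintro ⟨_, x, hx, rfl⟩
    exact h x hx

lemma evalZ_surjective (n : ℕ) : Function.Surjective (evalZ k X A n) := by
  intro g
  -- Homology is a subspace of chains modulo boundaries, so `g` extends to that quotient; the
  -- pullback to chains is a cocycle.
  obtain ⟨u, hu⟩ := LinearMap.exists_extend g
  let w : (X _⦋n⦌ →₀ k) →ₗ[k] A := u ∘ₗ (LinearMap.range (boundary k X n)).mkQ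
  refine ⟨⟨fun σ ↦ w (Finsupp.single σ 1), ?_⟩, LinearMap.ext ?_⟩
  · rw [mem_Z_iff (k := k), linearCombination_single_one]
    refine LinearMap.ext fun x ↦ ?_
    have h0 : (LinearMap.range (boundary k X n)).mkQ (boundary k X n x) = 0 :=
      (Submodule.Quotient.mk_eq_zero _).2 ⟨x, rfl⟩
    simp only [w, LinearMap.comp_apply, h0, map_zero, LinearMap.zero_apply]
  · rintro ⟨_, x, hx, rfl⟩
    refine (LinearMap.congr_fun (linearCombination_single_one n w) x).trans ?_
    exact LinearMap.congr_fun hu ⟨_, x, hx, rfl⟩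

/-- Over a field, cohomology is dual to homology. -/
noncomputable def hEquiv (n : ℕ) : H A X n ≃ₗ[A] (Homology k X n →ₗ[k] A) :=
  LinearEquiv.ofBijective
    (Submodule.liftQ _ (evalZ k X A n) fun φ hφ ↦ (evalZ_eq_zero_iff k X A n φ).2 hφ)
    ⟨LinearMap.ker_eq_bot.1 (Submodule.ker_liftQ_eq_bot _ _ _ fun φ hφ ↦
      (evalZ_eq_zero_iff k X A n φ).1 hφ),
      fun g ↦ (evalZ_surjective k X A n g).imp' mkH fun _ h ↦ h⟩

variable {k X A}

lemma hEquiv_coeffH (n : ℕ) (x : H k X n) : hEquiv k X A n (coeffH (algebraMap k A) X n x) =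
    Algebra.linearMap k A ∘ₗ hEquiv k X k n x := by
  obtain ⟨φ, rfl⟩ := mkH_surjective x
  change evalZ k X A n (coeffZ (algebraMap k A) X n φ) = Algebra.linearMap k A ∘ₗ evalZ k X k n φ
  have h : Finsupp.linearCombination k (coeffCochain (algebraMap k A) X n φ.1) =
      Algebra.linearMap k A ∘ₗ Finsupp.linearCombination k φ.1 := by
    refine Finsupp.lhom_ext' fun σ ↦ LinearMap.ext_ring ?_
    simp [coeffCochain]
  refine LinearMap.ext ?_
  rintro ⟨_, x, hx, rfl⟩
  exact LinearMap.congr_fun h x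

/-- When `A ≠ 0`, finiteness of `Hom(Homology k X n, A)` makes the homology finite-dimensional;
under `hEquiv` the map becomes the isomorphism `dualTensorHomEquiv`. -/
theorem coeffTensor_bijective_of_field (n : ℕ) [Module.Finite A (H A X n)] :
    Function.Bijective (coeffTensor k A X n) := by
  rcases subsingleton_or_nontrivial A with hA | hA
  · have := Module.subsingleton A (H A X n)
    have := Module.subsingleton A (A ⊗[k] H k X n)
    exact ⟨fun _ _ _ ↦ Subsingleton.elim _ _, fun y ↦ ⟨0, Subsingleton.elim _ _⟩⟩
  have : Module.Finite A (Homology k X n →ₗ[k] A) := Module.Finite.equiv (hEquiv k X A n)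
  have : Module.Finite k (Homology k X n) := Module.Finite.of_finite_hom (A := A)
  let e := TensorProduct.comm k A (H k X n) ≪≫ₗ
    TensorProduct.congr (hEquiv k X k n) (LinearEquiv.refl k A) ≪≫ₗ dualTensorHomEquiv k _ A
  have he : ∀ t, hEquiv k X A n (coeffTensor k A X n t) = e t := by
    intro t
    induction t with
    | zero => simp
    | tmul a x =>
      rw [coeffTensor_tmul, map_smul, hEquiv_coeffH]
      refine LinearMap.ext fun y ↦ ?_
      simp [e, dualTensorHom_apply, Algebra.smul_def, mul_comm]
    | add t t' ht ht' => simp only [map_add, ht, ht']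
  refine (Function.Bijective.of_comp_iff' (hEquiv k X A n).bijective _).1 ?_
  convert e.bijective using 1
  exact funext he

end Field

/-! ### From degreewise bijections to graded algebra isomorphisms. -/

section Algebra

variable (R : Type v) [CommRing R] (S : Type w) [CommRing S] (X : SSet.{u})

lemma coeffH_cupH {i j n : ℕ} (h : i + j = n) (f : R →+* S) (x : H R X i) (y : H R X j) :
    coeffH f X n (cupH R X h x y) = cupH S X h (coeffH f X i x) (coeffH f X j y) := by
  obtain ⟨x, rfl⟩ := mkH_surjective x
  obtain ⟨y, rfl⟩ := mkH_surjective y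
  exact congrArg mkH (Subtype.ext (funext fun σ ↦ map_mul f _ _))

lemma coeffH_oneH (f : R →+* S) : coeffH f X 0 (oneH R X) = oneH S X :=
  congrArg mkH (Subtype.ext (funext fun _ ↦ map_one f))

theorem exists_algEquiv_of_bijective [Algebra R S] (h : ∀ n, Function.Bijective (coeffTensor R S X n)) :
    ∃ e : (S ⊗[R] DirectSum ℕ (H R X)) ≃ₐ[S] DirectSum ℕ (H S X),
      ∀ (n : ℕ) (a : S) (x : H R X n), e (a ⊗ₜ[R] DirectSum.lof R ℕ (H R X) n x) =
        DirectSum.lof S ℕ (H S X) n (a • coeffH (algebraMap R S) X n x) := by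
  let E : (S ⊗[R] DirectSum ℕ (H R X)) ≃ₗ[S] DirectSum ℕ (H S X) :=
    TensorProduct.directSumRight R S S (H R X) ≪≫ₗ
      DFinsupp.mapRange.linearEquiv fun n ↦ LinearEquiv.ofBijective (coeffTensor R S X n) (h n)
  have hE : ∀ (n : ℕ) (a : S) (x : H R X n), E (a ⊗ₜ[R] DirectSum.lof R ℕ (H R X) n x) =
      DirectSum.lof S ℕ (H S X) n (a • coeffH (algebraMap R S) X n x) := by
    intro n a x
    simp only [E, LinearEquiv.trans_apply, TensorProduct.directSumRight_tmul_lof]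
    exact DFinsupp.mapRange_single (hf := fun n ↦ map_zero (coeffTensor R S X n))
  refine ⟨Algebra.TensorProduct.algEquivOfLinearEquivTensorProduct E ?_ ?_, hE⟩
  · intro a b x y
    induction x using DirectSum.induction_on with
    | zero => simp
    | add x x' hx hx' => simp only [add_mul, tmul_add, map_add, hx, hx']
    | of i x =>
      induction y using DirectSum.induction_on with
      | zero => simp
      | add y y' hy hy' => simp only [mul_add, tmul_add, map_add, hy, hy']
      | of j y =>
        rw [DirectSum.of_mul_of]
        refine (hE _ _ _).trans ?_
        refine Eq.trans ?_ (congrArg₂ _ (hE i a x).symm (hE j b y).symm)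
        refine Eq.trans ?_ (DirectSum.of_mul_of _ _).symm
        refine congrArg (DirectSum.lof S ℕ (H S X) (i + j)) ?_
        change (a * b) • coeffH _ X _ (cupH R X rfl x y) = cupH S X rfl (a • _) (b • _)
        rw [coeffH_cupH, map_smul (cupH S X rfl), LinearMap.smul_apply, map_smul, mul_smul]
  · refine (hE 0 1 (oneH R X)).trans ?_
    rw [one_smul, coeffH_oneH]
    rfl

end Algebra

end SSetCochain

open scoped TensorProduct

/-- The argument covers every ring `R` and every space `Y` whose cohomology over `R` is finite free, so
`hfin` is not needed: `Ext` of the integral homology is a direct summand of `H^*(Y; R)`, hence flat and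
finite, and this suffices to compare `R` with `R / p`. -/
theorem proposition2p4 (R : Type v) [CommRing R] (Y : Type u) [TopologicalSpace Y]
    (p : ℕ) [Fact p.Prime]
    (hfree : ∀ n, Module.Free R (SingularCohomology R Y n) ∧
      Module.Finite R (SingularCohomology R Y n))
    (hfin : (IsNoetherianRing R ∧ ringKrullDim R < ⊤) ∨ HasFiniteType Y) :
    (∃ e : (ModP R p ⊗[R] SingularCohomologyAlgebra R Y) ≃ₐ[ModP R p]
          SingularCohomologyAlgebra (ModP R p) Y,
      ∀ (n : ℕ) (a : ModP R p) (x : SingularCohomology R Y n),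
        e (a ⊗ₜ[R] SingularCohomology.incl R Y n x) =
          SingularCohomology.incl (ModP R p) Y n
            (a • SingularCohomology.coeff (algebraMap R (ModP R p)) Y n x)) ∧
    (∃ e : (ModP R p ⊗[ZMod p] SingularCohomologyAlgebra (ZMod p) Y) ≃ₐ[ModP R p]
          SingularCohomologyAlgebra (ModP R p) Y,
      ∀ (n : ℕ) (a : ModP R p) (x : SingularCohomology (ZMod p) Y n),
        e (a ⊗ₜ[ZMod p] SingularCohomology.incl (ZMod p) Y n x) =
          SingularCohomology.incl (ModP R p) Y n
            (a • SingularCohomology.coeff (algebraMap (ZMod p) (ModP R p)) Y n x)) := by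

  have hsurj : Function.Surjective (algebraMap R (ModP R p)) := Ideal.Quotient.mk_surjective
  have hker : ∀ r, algebraMap R (ModP R p) r = 0 ↔ ∃ s, r = p * s := fun r ↦
    Ideal.Quotient.eq_zero_iff_mem.trans Ideal.mem_span_singleton
  have hflat : ∀ n, Module.Flat R (SingularCohomology R Y n) := fun n ↦
    have := (hfree n).1
    inferInstance
  have hfinite : ∀ n, Module.Finite R (SingularCohomology R Y n) := fun n ↦ (hfree n).2
  have hcoeff : ∀ n, Function.Surjective (SingularCohomology.coeff (algebraMap R (ModP R p)) Y n) :=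
    fun n ↦ SSetCochain.coeffH_surjective _ n hsurj hker
  refine ⟨SSetCochain.exists_algEquiv_of_bijective R (ModP R p) _ fun n ↦
    SSetCochain.coeffTensor_bijective_of_surjective n hsurj p ((hker _).2 ⟨1, by simp⟩) (hcoeff n)
      (SSetCochain.exists_eq_smul_of_coeffH_eq_zero _ n hsurj hker),
    SSetCochain.exists_algEquiv_of_bijective (ZMod p) (ModP R p) _ fun n ↦ ?_⟩
  -- Finiteness over `R/p` is inherited from `H^n(Y; R)` through the surjective reduction map.
  have : Module.Finite (ModP R p) (SingularCohomology (ModP R p) Y n) :=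
    Module.Finite.of_surjective _ (hcoeff n)
  exact SSetCochain.coeffTensor_bijective_of_field n
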